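/- Let $K$ be a number field with ring of integers $R$, let $K_\infty=\prod_{v\mid\infty}K_v$ be the product of the completions of $K$ at its infinite places, let $\widehat R=\prod_{\mathfrak p}R_{\mathfrak p}$ be the product of the completed local rings over the finite places, let $\mathbb A$ be the ring of adèles of $K$, and let $\mathbb A^\infty=K_\infty\times\widehat R\subset\mathbb A$ be the subring of adèles that are integral at every finite place. Embed $K$ diagonally in $\mathbb A$; embed $\mathrm{GL}_2(K_\infty)$ and $\mathrm{GL}_2(\widehat R)$ in $\mathrm{GL}_2(\mathbb A)$ by putting the identity matrix at all finite, respectively infinite, places. For every ideal class $c\in\mathrm{Cl}(K)$ choose an idèle $\alpha=\alpha_c\in\mathbb A^\times$ whose entries at the infinite places are all $1$ and whose fractional ideal $\prod_{\mathfrak p}\mathfrak p^{\nu_{\mathfrak p}(\alpha_{\mathfrak p})}$ lies in the class $c$. Put $$\boldsymbol\alpha=\begin{pmatrix}0&\alpha\\-1&0\end{pmatrix}\in\mathrm{GL}_2(\mathbb A),\qquad \Gamma_\alpha=\mathrm{GL}_2(K)\cap\boldsymbol\alpha^{-1}\,\mathrm{GL}_2(\mathbb A^\infty)\,\boldsymbol\alpha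 .$$ Then $$\mathrm{GL}_2(\mathbb A)/\mathrm{GL}_2(K)=\bigsqcup_{\alpha}\ \mathrm{GL}_2(\widehat R)\times\mathrm{GL}_2(K_\infty)/\Gamma_\alpha ,$$ where $\alpha$ runs over the chosen representatives $\alpha_c$, $c\in\mathrm{Cl}(K)$, in both of the following senses. (1) Let $\Gamma_\alpha$ act on the right on $\mathrm{GL}_2(\widehat R)\times\mathrm{GL}_2(K_\infty)$ through the embedding whose first component sends $\gamma$ to the finite part of $\boldsymbol\alpha\gamma\boldsymbol\alpha^{-1}$ and whose second component sends $\gamma$ to its image in $\mathrm{GL}_2(K_\infty)$. Then the maps $(x,g)\mapsto x\,\boldsymbol\alpha\, g\,\mathrm{GL}_2(K)$ induce a well-defined bijection $$\bigsqcup_{\alpha}\bigl(\mathrm{GL}_2(\widehat R)\times\mathrm{GL}_2(K_\infty)\bigr)/\Gamma_\alpha\ \longrightarrow\ \mathrm{GL}_2(\mathbb A)/\mathrm{GL}_2(K).$$ (2) There is a bijection $$\Psi:\ \bigsqcup_{\alpha}\ \mathrm{GL}_2(\widehat R)\times\bigl(\mathrm{GL}_2(K_\infty)/\Gamma_\alpha\bigr)\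 \longrightarrow\ \mathrm{GL}_2(\mathbb A)/\mathrm{GL}_2(K)$$ that is equivariant for left multiplication by $\mathrm{GL}_2(\widehat R)$ (acting on the source through the first factor) and that sends $(x,g\Gamma_\alpha)$, for all $x\in\mathrm{GL}_2(\widehat R)$ and $g\in\mathrm{GL}_2(K_\infty)$, into $\mathrm{GL}_2(\widehat R)\,\boldsymbol\alpha\, g\,\mathrm{GL}_2(K)$. -/

import Mathlib

open NumberField IsDedekindDomain
open scoped nonZeroDivisors

noncomputable section

namespace AdelicGL2

/-- The homomorphism `GL_n(A) × GL_n(B) → GL_n(A × B)` that pairs the entries of two matrices. -/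
def prodGL (n : Type*) [Fintype n] [DecidableEq n] (A B : Type*) [CommRing A] [CommRing B] :
    GL n A × GL n B →* GL n (A × B) :=
  (Units.map
    ({ toFun := fun p => Matrix.of fun i j => (p.1 i j, p.2 i j)
       map_one' := by
         ext i j <;> by_cases h : i = j <;> simp [Matrix.one_apply, h]
       map_mul' := by
         intro p q
         ext i j <;> simp [Matrix.mul_apply, Prod.fst_sum, Prod.snd_sum] } :
      Matrix n n A × Matrix n n B →* Matrix n n (A × B))).comp
    (MulEquiv.prodUnits (M := Matrix n n A) (N := Matrix n n B)).symm.toMonoidHom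

variable (K : Type*) [Field K] [NumberField K]

/-- The adele ring `𝔸` of the number field `K`. -/
abbrev Adele : Type _ := AdeleRing (𝓞 K) K

/-- The ring `R̂ = ∏_𝔭 R_𝔭`, over the finite places `𝔭` of `K`. -/
abbrev RHat : Type _ := (v : HeightOneSpectrum (𝓞 K)) → v.adicCompletionIntegers K

/-- The inclusion of `R̂` in the finite adeles. -/
def rHatToFinite : RHat K →+* FiniteAdeleRing (𝓞 K) K where
  toFun x := ⟨fun v => (x v : v.adicCompletion K), .of_forall fun v => (x v).2⟩
  map_one' := rfl
  map_mul' _ _ := rfl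
  map_zero' := rfl
  map_add' _ _ := rfl

/-- The projection of `𝔸` onto the finite adeles. -/
def toFinite : Adele K →+* FiniteAdeleRing (𝓞 K) K :=
  RingHom.snd (InfiniteAdeleRing K) (FiniteAdeleRing (𝓞 K) K)

/-- The ring `𝔸^∞ = K_∞ × R̂` of `S`-adeles for `S` the set of infinite places: the adeles that are
integral at every finite place. -/
def inftyAdeles : Subring (Adele K) := (rHatToFinite K).range.comap (toFinite K)

/-- `GL_2(𝔸^∞)` as a subgroup of `GL_2(𝔸)`. -/
def GLInftyAdeles : Subgroup (GL (Fin 2) (Adele K)) :=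
  (Matrix.GeneralLinearGroup.map (n := Fin 2) (inftyAdeles K).subtype).range

/-- The diagonal embedding `GL_2(K) → GL_2(𝔸)`. -/
def diagGL : GL (Fin 2) K →* GL (Fin 2) (Adele K) :=
  Matrix.GeneralLinearGroup.map (algebraMap K (Adele K))

/-- `GL_2(K)` as a subgroup of `GL_2(𝔸)`. -/
def principalGL : Subgroup (GL (Fin 2) (Adele K)) := (diagGL K).range

/-- The embedding `GL_2(K_∞) → GL_2(𝔸)`, equal to `1` at the finite places. -/
def inftyGL : GL (Fin 2) (InfiniteAdeleRing K) →* GL (Fin 2) (Adele K) :=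
  (prodGL (Fin 2) (InfiniteAdeleRing K) (FiniteAdeleRing (𝓞 K) K)).comp (MonoidHom.inl _ _)

/-- The embedding `GL_2(R̂) → GL_2(𝔸)`, equal to `1` at the infinite places. -/
def rHatGL : GL (Fin 2) (RHat K) →* GL (Fin 2) (Adele K) :=
  ((prodGL (Fin 2) (InfiniteAdeleRing K) (FiniteAdeleRing (𝓞 K) K)).comp
    (MonoidHom.inr _ _)).comp (Matrix.GeneralLinearGroup.map (rHatToFinite K))

variable {K}

/-- A finite place as an invertible fractional ideal. -/
def primeUnit (v : HeightOneSpectrum (𝓞 K)) : (FractionalIdeal (𝓞 K)⁰ K)ˣ :=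
  Units.mk0 (v.asIdeal : FractionalIdeal (𝓞 K)⁰ K) (FractionalIdeal.coeIdeal_ne_zero.2 v.ne_bot)

/-- The additive valuation `ν_𝔭(a_𝔭)` of an idele at a finite place, normalized to have value `1` at
a uniformizer. -/
def ideleVal (a : (Adele K)ˣ) (v : HeightOneSpectrum (𝓞 K)) : ℤ :=
  -WithZero.log (Valued.v (a.val.2 v))

/-- The fractional ideal `∏_𝔭 𝔭 ^ ν_𝔭(a_𝔭)` of an idele; almost all factors are `1`. -/
def ideleIdeal (a : (Adele K)ˣ) : (FractionalIdeal (𝓞 K)⁰ K)ˣ :=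
  ∏ᶠ v : HeightOneSpectrum (𝓞 K), primeUnit v ^ ideleVal a v

/-- A system of idele representatives of the class group: for each ideal class `c`, an idele whose
entries at the infinite places are all `1` and whose fractional ideal lies in `c`. -/
structure IdeleReps (α : ClassGroup (𝓞 K) → (Adele K)ˣ) : Prop where
  infinite_eq_one : ∀ c, (α c).val.1 = 1
  class_eq : ∀ c, ClassGroup.mk K (ideleIdeal (α c)) = c

/-- The element `𝛂 = [[0, α], [-1, 0]]` of `GL_2(𝔸)`, of determinant `α`. -/
def bold (a : (Adele K)ˣ) : GL (Fin 2) (Adele K) where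
  val := !![0, (a : Adele K); -1, 0]
  inv := !![0, -1; ((a⁻¹ : (Adele K)ˣ) : Adele K), 0]
  val_inv := by
    ext i j
    fin_cases i <;> fin_cases j <;> simp [Matrix.mul_apply, Fin.sum_univ_two]
  inv_val := by
    ext i j
    fin_cases i <;> fin_cases j <;> simp [Matrix.mul_apply, Fin.sum_univ_two]

/-- `Γ_α = GL_2(K) ∩ 𝛂⁻¹ GL_2(𝔸^∞) 𝛂`, as a subgroup of `GL_2(K)`. -/
def Gam (a : (Adele K)ˣ) : Subgroup (GL (Fin 2) K) :=
  ((GLInftyAdeles K).comap (MulAut.conj (bold a)).toMonoidHom).comap (diagGL K)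

/-- `Γ_α` as a subgroup of `GL_2(K_∞)`. -/
def GamInfty (a : (Adele K)ˣ) : Subgroup (GL (Fin 2) (InfiniteAdeleRing K)) :=
  (Gam a).map (Matrix.GeneralLinearGroup.map (algebraMap K (InfiniteAdeleRing K)))

/-- The homomorphism from `GL_2(K)` to `GL_2` of the finite adeles times `GL_2(K_∞)` that sends `γ`
to (the finite part of `𝛂 γ 𝛂⁻¹`, `γ`). -/
def twistedDiag (a : (Adele K)ˣ) :
    GL (Fin 2) K →* GL (Fin 2) (FiniteAdeleRing (𝓞 K) K) × GL (Fin 2) (InfiniteAdeleRing K) :=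
  MonoidHom.prod
    ((Matrix.GeneralLinearGroup.map (toFinite K)).comp
      ((MulAut.conj (bold a)).toMonoidHom.comp (diagGL K)))
    (Matrix.GeneralLinearGroup.map (algebraMap K (InfiniteAdeleRing K)))

/-- `Γ_α` embedded diagonally in `GL_2(R̂) × GL_2(K_∞)`, through `γ ↦ 𝛂 γ 𝛂⁻¹` in the first factor
and `γ ↦ γ` in the second. -/
def GamDiag (a : (Adele K)ˣ) :
    Subgroup (GL (Fin 2) (RHat K) × GL (Fin 2) (InfiniteAdeleRing K)) :=
  ((Gam a).map (twistedDiag a)).comap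
    ((Matrix.GeneralLinearGroup.map (n := Fin 2) (rHatToFinite K)).prodMap (MonoidHom.id _))

end AdelicGL2

end

/-! The content is a double coset decomposition at the finite places: `GL_2(R̂) \ GL_2(finite
adeles) / GL_2(K)` is indexed by `Cl(K)`, through the ideal class of the determinant. The infinite
component costs nothing, since the factor `g` in `x 𝛂 g` is arbitrary.

Existence (`exists_finite_decomposition`): `R̂` is Bezout relative to the finite adeles, so row
operations make a matrix triangular. Strong approximation then clears the corner and turns the
diagonal matrix into `[[0, b], [-1, 0]]` (`reducesToAnti_of_isUnit_det`). When `b` and `α_c` have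
the same ideal class they differ by an element of `Kˣ` and a unit of `R̂`, and diagonal matrices
absorb both.

Uniqueness (`mk_eq_mk_iff`): an equality of cosets is witnessed by some `γ` in `GL_2(K)`.
Determinants show that the two classes agree (`mk_ideleIdeal_eq_of_conj`); then `γ` is conjugate by
`𝛂` into `GL_2(R̂)` at the finite places, so it lies in `Γ_α`. This is the bijection of (1).

For (2), one representative `g` is fixed in each coset of `Γ_α`. Changing `g` within its coset
multiplies `x` on the right only, so left equivariance survives; injectivity uses that `γ` is
determined by its image at infinity. -/

namespace AdelicGL2

open HeightOneSpectrum

/-! ### Matrix reduction from Bezout, denominators and strong approximation -/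

section Decomposition

variable {O F L : Type*} [CommRing O] [CommRing F] [Field L] (ι : O →+* F) (j : L →+* F)

/-- `H` can be brought to the form `[[0, b], [-1, 0]]` by multiplying it by a matrix of determinant
`1` over `O` on the left and by an invertible matrix over `L` on the right. -/
def ReducesToAnti (H : Matrix (Fin 2) (Fin 2) F) : Prop :=
  ∃ (X : Matrix (Fin 2) (Fin 2) O) (G : Matrix (Fin 2) (Fin 2) L) (b : F),
    X.det = 1 ∧ G.det ≠ 0 ∧ X.map ι * H * G.map j = !![0, b; -1, 0]

variable {ι j}

theorem ReducesToAnti.of_mul {H H' : Matrix (Fin 2) (Fin 2) F} (X : Matrix (Fin 2) (Fin 2) O)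
    (G : Matrix (Fin 2) (Fin 2) L) (hX : X.det = 1) (hG : G.det ≠ 0)
    (h : X.map ι * H * G.map j = H') (h' : ReducesToAnti ι j H') : ReducesToAnti ι j H := by
  obtain ⟨X', G', b, hX', hG', e⟩ := h'
  refine ⟨X' * X, G * G', b, by simp [hX, hX'], by simp [hG, hG'], ?_⟩
  rw [← e, ← h, Matrix.map_mul, Matrix.map_mul]
  simp only [Matrix.mul_assoc]

theorem map_of_two {A B : Type*} (f : A → B) (a b c d : A) :
    (!![a, b; c, d]).map f = !![f a, f b; f c, f d] := by
  ext i k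
  fin_cases i <;> fin_cases k <;> rfl

/-- If additive strong approximation holds, then a matrix with first column `(0, -1)` reduces. -/
theorem reducesToAnti_of_primitive
    (happ : ∀ (d : Fˣ) (x : F), ∃ (k : L) (u : O), x = j k + d * ι u) (b : Fˣ) (m : F) :
    ReducesToAnti ι j !![0, (b : F); -1, m] := by
  obtain ⟨k, u, h⟩ := happ b m
  refine ⟨!![1, 0; -u, 1], !![1, k; 0, 1], b, by simp, by simp, ?_⟩
  simp only [map_of_two, Matrix.mul_fin_two, map_one, map_zero, map_neg, h]
  congr 1
  ext i l
  fin_cases i <;> fin_cases l <;> simp; ring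

/-- If additive strong approximation holds, then an invertible diagonal matrix reduces. -/
theorem reducesToAnti_of_diagonal
    (hint : ∀ a : F, ∃ s : L, s ≠ 0 ∧ ∃ o : O, a * j s = ι o)
    (happ : ∀ (d : Fˣ) (x : F), ∃ (k : L) (u : O), x = j k + d * ι u) (g d : Fˣ) :
    ReducesToAnti ι j !![(g : F), 0; 0, (d : F)] := by
  obtain ⟨s, hs, o, hso⟩ := hint g
  -- Approximating `d⁻¹` modulo `d⁻¹ g s` and multiplying by `d` gives `d t + o u = 1`. Thus the
  -- column `(o, d t)` obtained from `s` and `t` is unimodular, and `X` below moves it to `(0, -1)`.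
  obtain ⟨t, u, h⟩ := happ (d⁻¹ * (g * Units.map j.toMonoidHom (Units.mk0 s hs))) (d⁻¹ : Fˣ)
  have h1 : (d : F) * j t + ι o * ι u = 1 := by
    have := congrArg ((d : F) * ·) h
    simp only [Units.mul_inv] at this
    rw [this, ← hso]
    simp [mul_add, ← mul_assoc]
  refine ReducesToAnti.of_mul !![-1 + o * u, o; -u, -1] !![s, 0; t, 1] ?_ (by simpa) rfl ?_
  · simp [Matrix.det_fin_two]
  · convert reducesToAnti_of_primitive happ (g * Units.map j.toMonoidHom (Units.mk0 s hs) * d)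
      (-(d : F)) using 1
    simp only [map_of_two, Matrix.mul_fin_two, map_one, map_zero, map_neg, map_add, map_mul]
    ext i l
    fin_cases i <;> fin_cases l
    · simp
      linear_combination (ι o * ι u - 1) * hso + ι o * h1
    · simp [← hso]
    · simp
      linear_combination (- ι u) * hso - h1
    · simp

/-- The double coset decomposition of `GL_2(F)`: every matrix reduces if `O` is a Bezout ring
relative to `F`, elements of `F` have denominators in `L`, and additive strong approximation
holds. -/
theorem reducesToAnti_of_isUnit_det
    (hbez : ∀ a c : F, ∃ (x y a' c' : O) (g : F),
      x * a' + y * c' = 1 ∧ a = g * ι a' ∧ c = g * ι c')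
    (hint : ∀ a : F, ∃ s : L, s ≠ 0 ∧ ∃ o : O, a * j s = ι o)
    (happ : ∀ (d : Fˣ) (x : F), ∃ (k : L) (u : O), x = j k + d * ι u)
    (H : Matrix (Fin 2) (Fin 2) F) (hH : IsUnit H.det) : ReducesToAnti ι j H := by
  obtain ⟨x, y, a', c', g, h1, ha, hc⟩ := hbez (H 0 0) (H 1 0)
  have h1' : ι x * ι a' + ι y * ι c' = 1 := by rw [← map_mul, ← map_mul, ← map_add, h1, map_one]
  set n := ι x * H 0 1 + ι y * H 1 1
  set d := -ι c' * H 0 1 + ι a' * H 1 1 with hd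
  have hdet : g * d = H.det := by
    rw [Matrix.det_fin_two, ha, hc, hd]; ring
  obtain ⟨g, rfl⟩ := isUnit_of_mul_isUnit_left (hdet ▸ hH)
  obtain ⟨d, hd'⟩ := isUnit_of_mul_isUnit_right (hdet ▸ hH)
  -- The Bezout relation completes the row `(x, y)` to a matrix of determinant `1` that sends the
  -- first column `g (a', c')` to `(g, 0)`.
  refine ReducesToAnti.of_mul (H' := !![(g : F), n; 0, (d : F)]) !![x, y; -c', a'] 1 ?_ (by simp)
    ?_ ?_
  · simp [Matrix.det_fin_two, h1]
  · rw [Matrix.map_one _ (map_zero j) (map_one j), mul_one, Matrix.eta_fin_two H, ha, hc, hd', hd]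
    simp only [map_of_two, Matrix.mul_fin_two, map_neg, n]
    ext i l
    fin_cases i <;> fin_cases l
    · simp
      linear_combination (g : F) * h1'
    · simp
    · simp
      ring
    · simp
  -- Here `n = g k + d u`: a column operation over `L` removes `g k` and a row operation over `O`
  -- removes `d u`.
  · obtain ⟨k, u, h⟩ := happ (g⁻¹ * d) (g⁻¹ * n)
    have h' : n = g * j k + d * ι u := by
      have := congrArg ((g : F) * ·) h
      simpa [mul_add, ← mul_assoc] using this
    refine ReducesToAnti.of_mul !![1, -u; 0, 1] !![1, -k; 0, 1] (by simp) (by simp) ?_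
      (reducesToAnti_of_diagonal hint happ g d)
    simp only [map_of_two, Matrix.mul_fin_two, map_one, map_zero, map_neg, h']
    ext i l
    fin_cases i <;> fin_cases l <;> simp
    ring

end Decomposition

/-! ### Strong approximation for the finite adeles -/

section IntegralApproximation

variable {R : Type*} [CommRing R] [IsDedekindDomain R] {K : Type*} [Field K] [Algebra R K]
  [IsFractionRing R K]

theorem adicCompletion_coe_sub (v : HeightOneSpectrum R) (a b : K) :
    ((a - b : K) : v.adicCompletion K) = a - b :=
  map_sub (algebraMap K (v.adicCompletion K)) a b

/-- The condition says that `(y - k) / d` is integral, which is open in `k`, and `K` is dense in its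
completion. -/
theorem exists_valued_sub_le (v : HeightOneSpectrum R) (y : v.adicCompletion K)
    {d : v.adicCompletion K} (hd : d ≠ 0) : ∃ k : K, Valued.v (y - k) ≤ Valued.v d := by
  have hd' : Valued.v d ≠ 0 := (Valuation.ne_zero_iff _).2 hd
  have hc : Continuous fun z : v.adicCompletion K => (y - z) * d⁻¹ :=
    (continuous_const.sub continuous_id).mul continuous_const
  have ho := (Valued.isOpen_integer (v.adicCompletion K)).preimage hc
  obtain ⟨_, hz, k, rfl⟩ :=
    (IsDedekindDomain.HeightOneSpectrum.denseRange_algebraMap K v).inter_open_nonempty _ ho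
      ⟨y, by simp⟩
  refine ⟨k, ?_⟩
  have : Valued.v ((y - (k : v.adicCompletion K)) * d⁻¹) ≤ 1 := hz
  rwa [map_mul, map_inv₀, mul_inv_le_iff₀ (zero_lt_iff.2 hd'), one_mul] at this

/-- If `d` is small, an approximation of `y` in `K` is itself integral at `v` by the ultrametric
inequality, and can be approximated in turn from `R`. -/
theorem exists_integer_valued_sub_le (v : HeightOneSpectrum R) {y d : v.adicCompletion K}
    (hy : Valued.v y ≤ 1) (hd : d ≠ 0) :
    ∃ m : R, Valued.v (y - (algebraMap R K m : K)) ≤ Valued.v d := by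
  rcases le_total 1 (Valued.v d) with h | h
  · exact ⟨0, by rw [map_zero, adicCompletion.coe_zero, sub_zero]; exact hy.trans h⟩
  obtain ⟨k, hk⟩ := exists_valued_sub_le v y hd
  have hk1 : v.valuation K k ≤ 1 := by
    rw [← valuedAdicCompletion_eq_valuation',
      ← sub_sub_cancel y (k : v.adicCompletion K)]
    exact (Valuation.map_sub _ _ _).trans (max_le hy (hk.trans h))
  obtain ⟨m, hm⟩ := v.exists_valuation_sub_lt_of_integer hk1
    (Units.mk0 (Valued.v d) ((Valuation.ne_zero_iff _).2 hd))
  refine ⟨m, ?_⟩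
  have e : y - ((algebraMap R K m : K) : v.adicCompletion K) =
      (y - k) - ((algebraMap R K m - k : K) : v.adicCompletion K) := by
    rw [adicCompletion_coe_sub]
    ring
  rw [e]
  refine (Valuation.map_sub _ _ _).trans (max_le hk ?_)
  rw [valuedAdicCompletion_eq_valuation']
  exact hm.le

/-- This is the Chinese remainder theorem for powers of distinct primes. -/
theorem exists_forall_intValuation_sub_le (S : Finset (HeightOneSpectrum R))
    (n : HeightOneSpectrum R → ℕ) (m : HeightOneSpectrum R → R) :
    ∃ r : R, ∀ v ∈ S, v.intValuation (r - m v) ≤ WithZero.exp (-(n v : ℤ)) := by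
  obtain ⟨r, hr⟩ := IsDedekindDomain.exists_forall_sub_mem_ideal (s := S)
    (fun v : HeightOneSpectrum R => v.asIdeal) n (fun v _ => v.prime)
    (fun v _ w _ h h' => h (HeightOneSpectrum.ext h')) (fun v => m v)
  exact ⟨r, fun v hv => (v.intValuation_le_pow_iff_mem _ _).2 (hr v hv)⟩

theorem exists_exp_neg_le {x : WithZero (Multiplicative ℤ)} (hx : x ≠ 0) :
    ∃ n : ℕ, WithZero.exp (-(n : ℤ)) ≤ x := by
  obtain ⟨n, h, -⟩ := WithZero.exists_exp_neg_natCast_lt_and_lt hx hx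
  exact ⟨n, h.le⟩

/-- There is a nonzero element of `R` whose valuations are at most prescribed ones at finitely many
primes. -/
theorem exists_ne_zero_forall_valuation_le (S : Finset (HeightOneSpectrum R))
    {γ : HeightOneSpectrum R → WithZero (Multiplicative ℤ)} (hγ : ∀ v, γ v ≠ 0) :
    ∃ r : R, r ≠ 0 ∧ ∀ v ∈ S, v.intValuation r ≤ γ v := by
  choose n hn using fun v => exists_exp_neg_le (hγ v)
  -- Any nonzero element of this product of prime powers will do.
  have hI : (∏ v ∈ S, v.asIdeal ^ n v) ≠ ⊥ :=
    Finset.prod_ne_zero_iff.2 fun v _ => pow_ne_zero _ v.ne_bot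
  obtain ⟨r, hr, hr0⟩ := Submodule.exists_mem_ne_zero_of_ne_bot hI
  refine ⟨r, hr0, fun v hv => ((v.intValuation_le_pow_iff_mem _ _).2 ?_).trans (hn v)⟩
  exact Ideal.le_of_dvd (Finset.dvd_prod_of_mem _ hv) hr

/-- Every finite adele has a denominator in `R`. -/
theorem exists_denominator (a : FiniteAdeleRing R K) :
    ∃ r : R, r ≠ 0 ∧ ∀ v, Valued.v (a v * (algebraMap R K r : K)) ≤ 1 := by
  have hS : {v | ¬ Valued.v (a v) ≤ 1}.Finite := a.2
  -- The value `1` only keeps the bound nonzero: the bound matters only at places where `a` is not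
  -- integral, hence nonzero.
  obtain ⟨r, hr, h⟩ := exists_ne_zero_forall_valuation_le hS.toFinset
    (γ := fun v => if Valued.v (a v) = 0 then 1 else (Valued.v (a v))⁻¹)
    (fun v => by split_ifs with h <;> simp [h])
  refine ⟨r, hr, fun v => ?_⟩
  rw [map_mul, valuedAdicCompletion_eq_valuation', valuation_of_algebraMap]
  by_cases hv : Valued.v (a v) ≤ 1
  · exact mul_le_one' hv (v.intValuation_le_one r)
  · have h0 : Valued.v (a v) ≠ 0 := fun h0 => hv (h0 ▸ zero_le)
    have := h v (by simpa using hv)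
    rw [if_neg h0] at this
    calc _ ≤ Valued.v (a v) * (Valued.v (a v))⁻¹ := mul_le_mul_right this _
      _ = 1 := mul_inv_cancel₀ h0

/-- The ring `R` is dense in the integral finite adeles. -/
theorem exists_integer_forall_valued_sub_le (y : FiniteAdeleRing R K)
    (hy : ∀ v, Valued.v (y v) ≤ 1) (d : (FiniteAdeleRing R K)ˣ) :
    ∃ m : R, ∀ v, Valued.v (y v - (algebraMap R K m : K)) ≤ Valued.v (d.val v) := by
  obtain ⟨hd0, hd1⟩ := FiniteAdeleRing.isUnit_iff.1 d.isUnit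
  have hS : {v | ¬ Valued.v (d.val v) = 1}.Finite := hd1
  choose m hm using fun v => exists_integer_valued_sub_le v (hy v) (hd0 v)
  choose n hn using fun v => exists_exp_neg_le ((Valuation.ne_zero_iff Valued.v).2 (hd0 v))
  obtain ⟨r, hr⟩ := exists_forall_intValuation_sub_le hS.toFinset n m
  refine ⟨r, fun v => ?_⟩
  -- Where `d` is a unit, integrality of both terms suffices; only finitely many places remain for
  -- the congruences.
  by_cases hv : Valued.v (d.val v) = 1
  · rw [hv]
    refine (Valuation.map_sub _ _ _).trans (max_le (hy v) ?_)
    rw [valuedAdicCompletion_eq_valuation']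
    exact v.valuation_le_one r
  · have e : y v - ((algebraMap R K r : K) : v.adicCompletion K) =
      (y v - (algebraMap R K (m v) : K)) -
        ((algebraMap R K (r - m v) : K) : v.adicCompletion K) := by
      rw [map_sub, adicCompletion_coe_sub]
      ring
    rw [e]
    refine (Valuation.map_sub _ _ _).trans (max_le (hm v) ?_)
    rw [valuedAdicCompletion_eq_valuation', valuation_of_algebraMap]
    exact (hr v (by simpa using hv)).trans (hn v)

theorem finiteAdele_mul_apply (a b : FiniteAdeleRing R K) (v : HeightOneSpectrum R) :
    (a * b) v = a v * b v := rfl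

/-- Strong approximation for the finite adeles. -/
theorem exists_sub_eq_mul_integral (d : (FiniteAdeleRing R K)ˣ) (x : FiniteAdeleRing R K) :
    ∃ (k : K) (u : FiniteAdeleRing R K), (∀ v, Valued.v (u v) ≤ 1) ∧
      x = algebraMap K _ k + d * u := by
  obtain ⟨r, hr, h⟩ := exists_denominator x
  have hr' : algebraMap R K r ≠ 0 := by simpa using hr
  set s : (FiniteAdeleRing R K)ˣ := FiniteAdeleRing.unitEmbedding R K (Units.mk0 _ hr') with hs
  have hsv : ∀ v, s.val v = (algebraMap R K r : K) := fun v => rfl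
  -- After clearing the denominator `r`, `x r ≡ m` modulo `d r`, so `k = m / r` and `u = (x r - m) /
  -- (d r)`.
  obtain ⟨m, hm⟩ := exists_integer_forall_valued_sub_le (x * s.val) h (d * s)
  refine ⟨algebraMap R K m * (algebraMap R K r)⁻¹,
    (d⁻¹ * s⁻¹ : (FiniteAdeleRing R K)ˣ) * (x * s.val - algebraMap K _ (algebraMap R K m)), ?_, ?_⟩
  · intro v
    have h1 : Valued.v ((d * s).val v) ≠ 0 :=
      (Valuation.ne_zero_iff _).2 ((FiniteAdeleRing.isUnit_iff.1 (d * s).isUnit).1 v)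
    have h2 : ((d⁻¹ * s⁻¹ : (FiniteAdeleRing R K)ˣ) : FiniteAdeleRing R K) v *
        (d * s).val v = 1 := by
      rw [← finiteAdele_mul_apply, ← Units.val_mul, ← mul_inv, inv_mul_cancel]
      rfl
    have h3 : Valued.v (((d⁻¹ * s⁻¹ : (FiniteAdeleRing R K)ˣ) : FiniteAdeleRing R K) v) *
        Valued.v ((d * s).val v) = 1 := by rw [← map_mul, h2, map_one]
    rw [finiteAdele_mul_apply, map_mul, ← h3]
    exact mul_le_mul_right (hm v) _
  · have hsi : (s⁻¹ : (FiniteAdeleRing R K)ˣ) =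
      algebraMap K (FiniteAdeleRing R K) (algebraMap R K r)⁻¹ := by
      rw [hs, ← map_inv]; rfl
    rw [map_mul, ← hsi, Units.val_mul]
    have e1 : (d : FiniteAdeleRing R K) * (d⁻¹ : (FiniteAdeleRing R K)ˣ) = 1 := d.mul_inv
    have e2 : (s : FiniteAdeleRing R K) * (s⁻¹ : (FiniteAdeleRing R K)ˣ) = 1 := s.mul_inv
    linear_combination (-x + algebraMap K (FiniteAdeleRing R K) (algebraMap R K m) *
      (s⁻¹ : (FiniteAdeleRing R K)ˣ)) * e1 - x * d * (d⁻¹ : (FiniteAdeleRing R K)ˣ) * e2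

end IntegralApproximation

/-- In a valuation ring one of two elements divides the other. The common divisor is written as `a *
x + c * y` so that the local choices, made place by place, assemble into a finite adele. -/
theorem exists_bezout_valuationSubring {F : Type*} [Field F] (A : ValuationSubring F) (a c : F) :
    ∃ x y a' c' : A, x * a' + y * c' = 1 ∧ a = (a * x + c * y) * a' ∧
      c = (a * x + c * y) * c' := by
  by_cases ha : a = 0
  · exact ⟨0, 1, 0, 1, by simp, by simp [ha], by simp⟩
  by_cases hc : c = 0
  · exact ⟨1, 0, 1, 0, by simp, by simp, by simp [hc]⟩
  rcases A.mem_or_inv_mem (c / a) with h | h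
  · exact ⟨1, 0, 1, ⟨_, h⟩, by simp, by simp, by simp; field_simp⟩
  · exact ⟨0, 1, ⟨_, h⟩, 1, by simp, by simp; field_simp, by simp⟩

/-! ### Integral finite adeles and ideal classes of ideles -/

section IdeleClasses

variable {K : Type*} [Field K] [NumberField K]

theorem rHatToFinite_injective : Function.Injective (rHatToFinite K) := fun _ _ h =>
  funext fun v => Subtype.ext (DFunLike.congr_fun h v)

theorem exists_rHatToFinite_eq {a : FiniteAdeleRing (𝓞 K) K} (ha : ∀ v, Valued.v (a v) ≤ 1) :
    ∃ o, rHatToFinite K o = a :=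
  ⟨fun v => ⟨a v, ha v⟩, FiniteAdeleRing.ext K fun _ => rfl⟩

theorem exists_bezout_rHat (a c : FiniteAdeleRing (𝓞 K) K) :
    ∃ (x y a' c' : RHat K) (g : FiniteAdeleRing (𝓞 K) K),
      x * a' + y * c' = 1 ∧ a = g * rHatToFinite K a' ∧ c = g * rHatToFinite K c' := by
  choose x y a' c' h1 h2 h3 using fun v =>
    exists_bezout_valuationSubring (v.adicCompletionIntegers K) (a v) (c v)
  exact ⟨x, y, a', c', a * rHatToFinite K x + c * rHatToFinite K y, funext h1,
    FiniteAdeleRing.ext K h2, FiniteAdeleRing.ext K h3⟩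

theorem exists_rHat_denominator (a : FiniteAdeleRing (𝓞 K) K) :
    ∃ s : K, s ≠ 0 ∧ ∃ o : RHat K, a * algebraMap K _ s = rHatToFinite K o := by
  obtain ⟨r, hr, h⟩ := exists_denominator a
  have h' : ∀ v, Valued.v ((a * algebraMap K (FiniteAdeleRing (𝓞 K) K) (algebraMap (𝓞 K) K r)) v)
      ≤ 1 := fun v => by
    rw [finiteAdele_mul_apply]
    exact h v
  obtain ⟨o, ho⟩ := exists_rHatToFinite_eq h'
  have hr' : algebraMap (𝓞 K) K r ≠ 0 := (map_ne_zero_iff _ (IsFractionRing.injective _ _)).2 hr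
  exact ⟨_, hr', o, ho.symm⟩

theorem rHat_strong_approximation (d : (FiniteAdeleRing (𝓞 K) K)ˣ) (x : FiniteAdeleRing (𝓞 K) K) :
    ∃ (k : K) (u : RHat K), x = algebraMap K _ k + d * rHatToFinite K u := by
  obtain ⟨k, u, hu, h⟩ := exists_sub_eq_mul_integral d x
  obtain ⟨o, rfl⟩ := exists_rHatToFinite_eq hu
  exact ⟨k, o, h⟩

/-- A finite idele is a unit of `R̂` if all its valuations are `1`. -/
theorem exists_unit_rHat {a : (FiniteAdeleRing (𝓞 K) K)ˣ} (ha : ∀ v, Valued.v (a.val v) = 1) :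
    ∃ u : (RHat K)ˣ, Units.map (rHatToFinite K).toMonoidHom u = a := by
  have hi : ∀ v, Valued.v ((a⁻¹).val v) = 1 := fun v => by
    have h : a.val v * (a⁻¹).val v = 1 := by
      rw [← finiteAdele_mul_apply, Units.mul_inv]; rfl
    have := congrArg Valued.v h
    rwa [map_mul, ha, one_mul, map_one] at this
  obtain ⟨o, ho⟩ := exists_rHatToFinite_eq fun v => (ha v).le
  obtain ⟨o', ho'⟩ := exists_rHatToFinite_eq fun v => (hi v).le
  have h : o * o' = 1 := rHatToFinite_injective (by rw [map_mul, ho, ho', Units.mul_inv, map_one])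
  exact ⟨⟨o, o', h, by rw [mul_comm, h]⟩, Units.ext ho⟩

theorem valued_unit_rHat (u : (RHat K)ˣ) (v : HeightOneSpectrum (𝓞 K)) :
    Valued.v (rHatToFinite K u.val v) = 1 :=
  adicCompletionIntegers.isUnit_iff_valued_eq_one.1 (u.isUnit.map (Pi.evalRingHom _ v))

theorem idele_snd_isUnit (a : (Adele K)ˣ) : IsUnit (a.val.2) := a.isUnit.map (toFinite K)

theorem idele_apply_ne_zero (a : (Adele K)ˣ) (v : HeightOneSpectrum (𝓞 K)) :
    Valued.v (a.val.2 v) ≠ 0 :=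
  (Valuation.ne_zero_iff _).2 ((FiniteAdeleRing.isUnit_iff.1 (idele_snd_isUnit a)).1 v)

theorem ideleVal_eventually_eq_zero (a : (Adele K)ˣ) :
    ∀ᶠ v in Filter.cofinite, ideleVal a v = 0 := by
  filter_upwards [(FiniteAdeleRing.isUnit_iff.1 (idele_snd_isUnit a)).2] with v hv
  simp [ideleVal, hv]

theorem ideleIdeal_val (a : (Adele K)ˣ) : ((ideleIdeal a : (FractionalIdeal (𝓞 K)⁰ K)ˣ) :
      FractionalIdeal (𝓞 K)⁰ K) = ∏ᶠ v : HeightOneSpectrum (𝓞 K),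
      (v.asIdeal : FractionalIdeal (𝓞 K)⁰ K) ^ ideleVal a v := by
  have hf : Function.HasFiniteMulSupport fun v => primeUnit v ^ ideleVal a v :=
    (Filter.eventually_cofinite.1 (ideleVal_eventually_eq_zero a)).subset
      fun v hv h => hv (by simp [h])
  rw [ideleIdeal, ← Units.coeHom_apply, MonoidHom.map_finprod _ hf]
  simp [primeUnit]

theorem count_ideleIdeal (a : (Adele K)ˣ) (v : HeightOneSpectrum (𝓞 K)) :
    FractionalIdeal.count K v (ideleIdeal a : (FractionalIdeal (𝓞 K)⁰ K)ˣ) = ideleVal a v := by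
  rw [ideleIdeal_val, FractionalIdeal.count_finprod _ _ _ (ideleVal_eventually_eq_zero a)]

theorem units_eq_of_count_eq {I J : (FractionalIdeal (𝓞 K)⁰ K)ˣ}
    (h : ∀ v, FractionalIdeal.count K v I.val = FractionalIdeal.count K v J.val) : I = J := by
  ext1
  rw [← FractionalIdeal.finprod_heightOneSpectrum_factorization' K I.ne_zero,
    ← FractionalIdeal.finprod_heightOneSpectrum_factorization' K J.ne_zero]
  simp [h]

theorem count_spanSingleton_algebraMap (v : HeightOneSpectrum (𝓞 K)) {n : 𝓞 K} (hn : n ≠ 0) :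
    FractionalIdeal.count K v (FractionalIdeal.spanSingleton (𝓞 K)⁰ (algebraMap (𝓞 K) K n)) =
      -WithZero.log (v.valuation K (algebraMap (𝓞 K) K n)) := by
  rw [← FractionalIdeal.coeIdeal_span_singleton, FractionalIdeal.count_coe _ _ (by simpa using hn),
    valuation_of_algebraMap, intValuation_if_neg _ hn, WithZero.log_exp, neg_neg]

theorem count_toPrincipalIdeal (v : HeightOneSpectrum (𝓞 K)) (k : Kˣ) :
    FractionalIdeal.count K v (toPrincipalIdeal (𝓞 K) K k : (FractionalIdeal (𝓞 K)⁰ K)ˣ) =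
      -WithZero.log (v.valuation K k) := by
  obtain ⟨n, d, hd, h⟩ := IsFractionRing.div_surjective (A := 𝓞 K) (k : K)
  have hd' : d ≠ 0 := nonZeroDivisors.ne_zero hd
  have hdK : algebraMap (𝓞 K) K d ≠ 0 := by simpa using hd'
  have hn : n ≠ 0 := by
    rintro rfl
    exact k.ne_zero (by rw [← h]; simp)
  have hk : k.val * algebraMap (𝓞 K) K d = algebraMap (𝓞 K) K n := by rw [← h]; field_simp
  have h1 := count_spanSingleton_algebraMap v hn
  rw [← hk, ← FractionalIdeal.spanSingleton_mul_spanSingleton, FractionalIdeal.count_mul _ _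
    (FractionalIdeal.spanSingleton_ne_zero_iff.2 k.ne_zero)
    (FractionalIdeal.spanSingleton_ne_zero_iff.2 hdK), count_spanSingleton_algebraMap v hd',
    map_mul,
    WithZero.log_mul (by simp) (by simpa using hd')] at h1
  rw [coe_toPrincipalIdeal]
  linarith

/-- Two ideles have ideals in the same class if and only if their valuations at the finite places
differ by those of an element of `K`. -/
theorem mk_ideleIdeal_eq_iff (a b : (Adele K)ˣ) :
    ClassGroup.mk K (ideleIdeal a) = ClassGroup.mk K (ideleIdeal b) ↔
      ∃ k : Kˣ, ∀ v, Valued.v (a.val.2 v) = Valued.v (b.val.2 v) * v.valuation K k.val := by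
  -- Invertible fractional ideals are determined by their exponents, so an equality of ideals can be
  -- tested by valuations.
  have key (k : Kˣ) : ideleIdeal a = ideleIdeal b * toPrincipalIdeal (𝓞 K) K k ↔
      ∀ v, Valued.v (a.val.2 v) = Valued.v (b.val.2 v) * v.valuation K k.val := by
    have hc (v : HeightOneSpectrum (𝓞 K)) :
        ideleVal a v = FractionalIdeal.count K v (ideleIdeal b * toPrincipalIdeal (𝓞 K) K k).val ↔
        Valued.v (a.val.2 v) = Valued.v (b.val.2 v) * v.valuation K k.val := by
      rw [Units.val_mul, FractionalIdeal.count_mul _ _ (Units.ne_zero _) (Units.ne_zero _),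
        count_ideleIdeal, count_toPrincipalIdeal, ideleVal, ideleVal, ← neg_add, neg_inj,
        ← WithZero.log_mul (idele_apply_ne_zero b v) (by simp)]
      refine ⟨fun h => ?_, fun h => by rw [h]⟩
      rw [← WithZero.exp_log (idele_apply_ne_zero a v), h, WithZero.exp_log]
      exact mul_ne_zero (idele_apply_ne_zero b v) (by simp)
    refine ⟨fun h v => (hc v).1 ?_, fun h => units_eq_of_count_eq fun v => ?_⟩
    · rw [← h, count_ideleIdeal]
    · rw [count_ideleIdeal, (hc v).2 (h v)]
  simp_rw [← key]
  have hid (I : (FractionalIdeal (𝓞 K)⁰ K)ˣ) :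
      Units.mapEquiv (MulEquiv.refl (FractionalIdeal (𝓞 K)⁰ K)) I = I := Units.ext rfl
  rw [← inv_mul_eq_one, ← map_inv, ← map_mul, ← (ClassGroup.equiv K).injective.eq_iff, map_one,
    ClassGroup.equiv_mk]
  simp only [FractionalIdeal.canonicalEquiv_self, RingEquiv.coe_mulEquiv_refl,
    QuotientGroup.mk'_apply, QuotientGroup.eq_one_iff, MonoidHom.mem_range, hid]
  constructor
  · rintro ⟨k, hk⟩
    exact ⟨k⁻¹, by rw [map_inv, hk]; simp⟩
  · rintro ⟨k, hk⟩
    exact ⟨k⁻¹, by rw [map_inv, hk]; simp⟩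

end IdeleClasses

/-! ### Adelic matrices and comparison of cosets -/

section AdelicMatrices

open Matrix (GeneralLinearGroup)

theorem generalLinearGroup_map_injective {A B : Type*} [CommRing A] [CommRing B] {f : A →+* B}
    (hf : Function.Injective f) : Function.Injective (GeneralLinearGroup.map (n := Fin 2) f) :=
  fun _ _ h => Units.ext <| Matrix.ext fun i k => hf (congrArg (fun Z : GL (Fin 2) B => Z i k) h)

/-- An invertible matrix comes from a subring if its entries and those of its inverse do. -/
theorem mem_range_generalLinearGroup_map {A B : Type*} [CommRing A] [CommRing B] {f : A →+* B}
    (hf : Function.Injective f) {M : GL (Fin 2) B} :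
    M ∈ (GeneralLinearGroup.map (n := Fin 2) f).range ↔
      ∀ i k, M i k ∈ f.range ∧ M⁻¹ i k ∈ f.range := by
  constructor
  · rintro ⟨N, rfl⟩ i k
    rw [← map_inv]
    exact ⟨⟨N i k, rfl⟩, ⟨N⁻¹ i k, rfl⟩⟩
  · intro h
    choose X hX using fun i k => (h i k).1
    choose Y hY using fun i k => (h i k).2
    have hX' : (Matrix.of X).map f = M.val := Matrix.ext hX
    have hY' : (Matrix.of Y).map f = M⁻¹.val := Matrix.ext hY
    have hinj : Function.Injective fun Z : Matrix (Fin 2) (Fin 2) A => Z.map f :=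
      Matrix.map_injective hf
    refine ⟨⟨Matrix.of X, Matrix.of Y, hinj ?_, hinj ?_⟩, Units.ext hX'⟩
    · simp only [Matrix.map_mul, hX', hY', Matrix.map_one _ (map_zero f) (map_one f), Units.mul_inv]
    · simp only [Matrix.map_mul, hX', hY', Matrix.map_one _ (map_zero f) (map_one f), Units.inv_mul]

variable (K : Type*) [Field K] [NumberField K]

/-- The component of an adelic matrix at the finite places. -/
noncomputable def finPart : GL (Fin 2) (Adele K) →* GL (Fin 2) (FiniteAdeleRing (𝓞 K) K) :=
  GeneralLinearGroup.map (toFinite K)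

/-- The component of an adelic matrix at the infinite places. -/
noncomputable def infPart : GL (Fin 2) (Adele K) →* GL (Fin 2) (InfiniteAdeleRing K) :=
  GeneralLinearGroup.map (RingHom.fst (InfiniteAdeleRing K) (FiniteAdeleRing (𝓞 K) K))

/-- The embedding of `GL_2(R̂)` in `GL_2` of the finite adeles. -/
noncomputable def rHatFin : GL (Fin 2) (RHat K) →* GL (Fin 2) (FiniteAdeleRing (𝓞 K) K) :=
  GeneralLinearGroup.map (rHatToFinite K)

/-- The diagonal embedding of `GL_2(K)` in `GL_2` of the finite adeles. -/
noncomputable def diagFin : GL (Fin 2) K →* GL (Fin 2) (FiniteAdeleRing (𝓞 K) K) :=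
  GeneralLinearGroup.map (algebraMap K _)

/-- The diagonal embedding of `GL_2(K)` in `GL_2(K_∞)`. -/
noncomputable def diagInf : GL (Fin 2) K →* GL (Fin 2) (InfiniteAdeleRing K) :=
  GeneralLinearGroup.map (algebraMap K _)

variable {K}

theorem adelicGL_ext {M N : GL (Fin 2) (Adele K)} (h1 : infPart K M = infPart K N)
    (h2 : finPart K M = finPart K N) : M = N :=
  Units.ext <| Matrix.ext fun i k => Prod.ext
    (congrArg (fun Z : GL (Fin 2) (InfiniteAdeleRing K) => Z i k) h1)
    (congrArg (fun Z : GL (Fin 2) (FiniteAdeleRing (𝓞 K) K) => Z i k) h2)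

@[simp] theorem infPart_inftyGL (g) : infPart K (inftyGL K g) = g := rfl

@[simp] theorem finPart_inftyGL (g) : finPart K (inftyGL K g) = 1 := rfl

@[simp] theorem infPart_rHatGL (x) : infPart K (rHatGL K x) = 1 := rfl

@[simp] theorem finPart_rHatGL (x) : finPart K (rHatGL K x) = rHatFin K x := rfl

@[simp] theorem infPart_diagGL (γ) : infPart K (diagGL K γ) = diagInf K γ := rfl

@[simp] theorem finPart_diagGL (γ) : finPart K (diagGL K γ) = diagFin K γ := rfl

theorem rHatFin_injective : Function.Injective (rHatFin K) :=
  generalLinearGroup_map_injective rHatToFinite_injective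

theorem diagInf_injective : Function.Injective (diagInf K) :=
  generalLinearGroup_map_injective (algebraMap K (InfiniteAdeleRing K)).injective

theorem infPart_bold {a b : (Adele K)ˣ} (ha : a.val.1 = 1) (hb : b.val.1 = 1) :
    infPart K (bold a) = infPart K (bold b) := by
  ext i k
  fin_cases i <;> fin_cases k
  · rfl
  · exact ha.trans hb.symm
  · rfl
  · rfl

/-- Integrality is a condition at the finite places only. -/
theorem mem_GLInftyAdeles {M : GL (Fin 2) (Adele K)} :
    M ∈ GLInftyAdeles K ↔ ∃ y, rHatFin K y = finPart K M := by
  rw [GLInftyAdeles, mem_range_generalLinearGroup_map (Subring.subtype_injective _),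
    Subring.range_subtype]
  exact (mem_range_generalLinearGroup_map rHatToFinite_injective (M := finPart K M)).symm

theorem mem_Gam {a : (Adele K)ˣ} {γ : GL (Fin 2) K} : γ ∈ Gam a ↔
    ∃ y, finPart K (bold a) * diagFin K γ = rHatFin K y * finPart K (bold a) := by
  refine mem_GLInftyAdeles.trans (exists_congr fun y => ?_)
  rw [← mul_inv_eq_iff_eq_mul, eq_comm, ← map_inv, ← finPart_diagGL, ← map_mul, ← map_mul]
  rfl

theorem mem_GamDiag {a : (Adele K)ˣ} {y : GL (Fin 2) (RHat K)}
    {h : GL (Fin 2) (InfiniteAdeleRing K)} : (y, h) ∈ GamDiag a ↔ ∃ γ : GL (Fin 2) K,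
      finPart K (bold a) * diagFin K γ = rHatFin K y * finPart K (bold a) ∧ diagInf K γ = h := by
  have hγ (γ : GL (Fin 2) K) : twistedDiag a γ =
      (finPart K (bold a) * diagFin K γ * (finPart K (bold a))⁻¹, diagInf K γ) := by
    rw [← map_inv, ← finPart_diagGL, ← map_mul, ← map_mul]
    rfl
  constructor
  · rintro ⟨γ, -, h'⟩
    rw [hγ] at h'
    exact ⟨γ, mul_inv_eq_iff_eq_mul.1 (congrArg Prod.fst h'), congrArg Prod.snd h'⟩
  · rintro ⟨γ, h1, h2⟩
    exact ⟨γ, mem_Gam.2 ⟨y, h1⟩, (hγ γ).trans (Prod.ext (mul_inv_eq_iff_eq_mul.2 h1) h2)⟩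

/-- The equation in `GL_2(𝔸)` splits into finite and infinite parts. At infinity both `bold a` and
`bold b` become the same matrix, which cancels. -/
theorem mk_eq_mk_iff {a b : (Adele K)ˣ} (ha : a.val.1 = 1) (hb : b.val.1 = 1)
    (x y : GL (Fin 2) (RHat K)) (g h : GL (Fin 2) (InfiniteAdeleRing K)) :
    (QuotientGroup.mk (rHatGL K x * bold a * inftyGL K g) : GL (Fin 2) (Adele K) ⧸ principalGL K) =
      QuotientGroup.mk (rHatGL K y * bold b * inftyGL K h) ↔
    ∃ γ : GL (Fin 2) K, rHatFin K x * finPart K (bold a) * diagFin K γ =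
      rHatFin K y * finPart K (bold b) ∧ g * diagInf K γ = h := by
  rw [QuotientGroup.eq]
  refine exists_congr fun γ => ?_
  rw [eq_inv_mul_iff_mul_eq]
  constructor
  · intro e
    refine ⟨by simpa using congrArg (finPart K) e, ?_⟩
    have := congrArg (infPart K) e
    simpa [infPart_bold ha hb, mul_assoc] using this
  · rintro ⟨h1, h2⟩
    refine adelicGL_ext ?_ (by simpa using h1)
    simp [infPart_bold ha hb, mul_assoc, h2]

theorem mk_eq_mk_iff_mem_GamDiag {a : (Adele K)ˣ} (ha : a.val.1 = 1)
    (p q : GL (Fin 2) (RHat K) × GL (Fin 2) (InfiniteAdeleRing K)) :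
    (QuotientGroup.mk (rHatGL K p.1 * bold a * inftyGL K p.2) :
        GL (Fin 2) (Adele K) ⧸ principalGL K) =
      QuotientGroup.mk (rHatGL K q.1 * bold a * inftyGL K q.2) ↔ p⁻¹ * q ∈ GamDiag a := by
  rw [mk_eq_mk_iff ha ha, show p⁻¹ * q = (p.1⁻¹ * q.1, p.2⁻¹ * q.2) from rfl, mem_GamDiag]
  refine exists_congr fun γ => and_congr ?_ eq_inv_mul_iff_mul_eq.symm
  rw [map_mul, map_inv, mul_assoc, mul_assoc, eq_inv_mul_iff_mul_eq]

/-- The map `(x, g) ↦ x 𝛂 g GL_2(K)` on the cosets of the diagonal image of `Γ_α`. -/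
noncomputable def integralCosetMap {a : (Adele K)ˣ} (ha : a.val.1 = 1) :
    (GL (Fin 2) (RHat K) × GL (Fin 2) (InfiniteAdeleRing K)) ⧸ GamDiag a →
      GL (Fin 2) (Adele K) ⧸ principalGL K :=
  Quotient.lift (s := QuotientGroup.leftRel (GamDiag a))
    (fun p => QuotientGroup.mk (rHatGL K p.1 * bold a * inftyGL K p.2))
    fun p q h => (mk_eq_mk_iff_mem_GamDiag ha p q).2 (QuotientGroup.leftRel_apply.1 h)

theorem finPart_bold_val (a : (Adele K)ˣ) :
    (finPart K (bold a)).val = !![0, a.val.2; -1, 0] := by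
  ext i k
  fin_cases i <;> fin_cases k <;> rfl

theorem det_finPart_bold (a : (Adele K)ˣ) : (finPart K (bold a)).val.det = a.val.2 := by
  rw [finPart_bold_val, Matrix.det_fin_two_of]
  ring

/-- Take determinants: those over `R̂` have valuation `1`, that of `𝛂` is `α`, and that of `γ` lies
in `Kˣ`. -/
theorem mk_ideleIdeal_eq_of_conj {a b : (Adele K)ˣ} {x y : GL (Fin 2) (RHat K)}
    {γ : GL (Fin 2) K} (h : rHatFin K x * finPart K (bold a) * diagFin K γ =
      rHatFin K y * finPart K (bold b)) :
    ClassGroup.mk K (ideleIdeal b) = ClassGroup.mk K (ideleIdeal a) := by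
  rw [mk_ideleIdeal_eq_iff]
  refine ⟨Matrix.GeneralLinearGroup.det γ, fun v => ?_⟩
  have hx (x : GL (Fin 2) (RHat K)) : Valued.v ((rHatFin K x).val.det v) = 1 := by
    rw [← valued_unit_rHat (Matrix.GeneralLinearGroup.det x) v]
    exact congrArg (fun z : FiniteAdeleRing (𝓞 K) K => Valued.v (z v))
      ((rHatToFinite K).map_det x.val).symm
  have hγ : (diagFin K γ).val.det = algebraMap K _ γ.val.det :=
    ((algebraMap K (FiniteAdeleRing (𝓞 K) K)).map_det γ.val).symm
  have e := congrArg (fun z => Valued.v (z.val.det v)) h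
  simp only [Units.val_mul, Matrix.det_mul, finiteAdele_mul_apply, map_mul, hx, one_mul, hγ,
    det_finPart_bold, FiniteAdeleRing.algebraMap_apply, valuedAdicCompletion_eq_valuation'] at e
  exact e.symm

/-- The double coset decomposition of `GL_2` of the finite adeles. -/
theorem exists_finite_decomposition {α : ClassGroup (𝓞 K) → (Adele K)ˣ} (hα : IdeleReps α)
    (H : GL (Fin 2) (FiniteAdeleRing (𝓞 K) K)) :
    ∃ (c : ClassGroup (𝓞 K)) (x : GL (Fin 2) (RHat K)) (γ : GL (Fin 2) K),
      rHatFin K x * finPart K (bold (α c)) = H * diagFin K γ := by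
  obtain ⟨X, G, b, hX, hG, e⟩ := reducesToAnti_of_isUnit_det (j := algebraMap K _)
    exists_bezout_rHat exists_rHat_denominator rHat_strong_approximation H.val
    ((Matrix.isUnit_iff_isUnit_det _).1 H.isUnit)
  have hb : IsUnit b := by
    have := congrArg Matrix.det e
    rw [Matrix.det_mul, Matrix.det_mul, Matrix.det_fin_two_of] at this
    have hX' : (X.map (rHatToFinite K)).det = 1 := by
      rw [← RingHom.mapMatrix_apply, ← RingHom.map_det, hX, map_one]
    have hG' : IsUnit (G.map (algebraMap K (FiniteAdeleRing (𝓞 K) K))).det := by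
      rw [← RingHom.mapMatrix_apply, ← RingHom.map_det]
      exact (IsUnit.mk0 _ hG).map _
    rw [hX', one_mul] at this
    have hb' : b = H.val.det * (G.map (algebraMap K (FiniteAdeleRing (𝓞 K) K))).det := by
      rw [this]; ring
    rw [hb']
    exact ((Matrix.isUnit_iff_isUnit_det _).1 H.isUnit).mul hG'
  obtain ⟨b, rfl⟩ := hb
  let b' : (Adele K)ˣ := MulEquiv.prodUnits.symm (1, b)
  set c := ClassGroup.mk K (ideleIdeal b')
  obtain ⟨k, hk⟩ := (mk_ideleIdeal_eq_iff (α c) b').1 (hα.class_eq c)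
  obtain ⟨f, hf⟩ := idele_snd_isUnit (α c)
  -- The class equality makes all valuations of `α_c / (b k)` equal to `1`, so it is a unit `u` of
  -- `R̂`.
  obtain ⟨u, hu⟩ := exists_unit_rHat (a := f * b⁻¹ * (FiniteAdeleRing.unitEmbedding (𝓞 K) K k)⁻¹)
    (fun v => by
      have e : (f * b⁻¹ * (FiniteAdeleRing.unitEmbedding (𝓞 K) K k)⁻¹) *
        (b * FiniteAdeleRing.unitEmbedding (𝓞 K) K k) = f := by
        rw [mul_assoc f, ← mul_inv, inv_mul_cancel_right]
      have e' := congrArg (fun z => Valued.v (z.val v)) e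
      have hb0 : Valued.v ((b : FiniteAdeleRing (𝓞 K) K) v) ≠ 0 := idele_apply_ne_zero b' v
      have hk0 : v.valuation K k.val ≠ 0 := by simp
      have hkv := hk v
      rw [← hf] at hkv
      change _ = Valued.v ((b : FiniteAdeleRing (𝓞 K) K) v) * _ at hkv
      simp only [Units.val_mul (_ * _ * _), Units.val_mul b, finiteAdele_mul_apply, map_mul,
        FiniteAdeleRing.unitEmbedding_apply, FiniteAdeleRing.algebraMap_apply,
        valuedAdicCompletion_eq_valuation', hkv] at e'
      exact mul_right_cancel₀ (mul_ne_zero hb0 hk0) (e'.trans (one_mul _).symm))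
  have hu' : (b : FiniteAdeleRing (𝓞 K) K) * algebraMap K _ k.val * rHatToFinite K u.val =
      (α c).val.2 := by
    have e : b * FiniteAdeleRing.unitEmbedding (𝓞 K) K k *
        Units.map (rHatToFinite K).toMonoidHom u = f := by
      rw [hu, mul_comm, mul_assoc f, ← mul_inv, inv_mul_cancel_right]
    exact (congrArg Units.val e).trans hf
  -- `diag(u, 1)` on the left and `diag(1, k)` on the right change `[[0, b], [-1, 0]]` into `[[0, u
  -- b k], [-1, 0]]`, which is the finite part of `𝛂`.
  let x : GL (Fin 2) (RHat K) := Matrix.GeneralLinearGroup.mk'' (!![u.val, 0; 0, 1] * X)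
    (by rw [Matrix.det_mul, hX, Matrix.det_fin_two_of]; simp)
  let γ : GL (Fin 2) K := Matrix.GeneralLinearGroup.mkOfDetNeZero (G * !![1, 0; 0, k.val])
    (by rw [Matrix.det_mul, Matrix.det_fin_two_of]; simpa using hG)
  refine ⟨c, x⁻¹, γ, ?_⟩
  rw [map_inv, inv_mul_eq_iff_eq_mul]
  refine Units.ext ?_
  have hx : (rHatFin K x).val =
      (!![u.val, 0; 0, 1]).map (rHatToFinite K) * X.map (rHatToFinite K) := Matrix.map_mul
  have hγ : (diagFin K γ).val = G.map (algebraMap K _) *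
    (!![1, 0; 0, k.val]).map (algebraMap K _) := Matrix.map_mul
  rw [Units.val_mul, Units.val_mul, hx, hγ, finPart_bold_val]
  calc _ = (!![u.val, 0; 0, 1]).map (rHatToFinite K) * !![0, (b : FiniteAdeleRing (𝓞 K) K); -1, 0] *
      (!![1, 0; 0, k.val]).map (algebraMap K _) := by
        simp only [map_of_two, Matrix.mul_fin_two, ← hu']
        refine Matrix.ext fun i l => ?_
        fin_cases i <;> fin_cases l <;> simp
        ring
    _ = _ := by rw [← e]; simp only [Matrix.mul_assoc]

theorem exists_decomposition {α : ClassGroup (𝓞 K) → (Adele K)ˣ} (hα : IdeleReps α)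
    (M : GL (Fin 2) (Adele K)) :
    ∃ (c : ClassGroup (𝓞 K)) (x : GL (Fin 2) (RHat K)) (g : GL (Fin 2) (InfiniteAdeleRing K)),
      (QuotientGroup.mk (rHatGL K x * bold (α c) * inftyGL K g) :
        GL (Fin 2) (Adele K) ⧸ principalGL K) = QuotientGroup.mk M := by
  obtain ⟨c, x, γ, h⟩ := exists_finite_decomposition hα (finPart K M)
  -- The `γ` found at the finite places also acts at infinity; `g` is solved for from that
  -- component.
  refine ⟨c, x, (infPart K (bold (α c)))⁻¹ * infPart K M * diagInf K γ,
    QuotientGroup.eq.2 ⟨γ⁻¹, ?_⟩⟩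
  rw [eq_inv_mul_iff_mul_eq]
  refine adelicGL_ext ?_ ?_
  · simp [mul_assoc]
  · simp [h]

end AdelicMatrices

end AdelicGL2

/-! ### The two parametrizations of the coset space -/

open AdelicGL2 in
theorem mainTheorem8 (K : Type*) [Field K] [NumberField K]
    (α : ClassGroup (𝓞 K) → (Adele K)ˣ) (hα : IdeleReps α) :
    (∃ Φ : (Σ c : ClassGroup (𝓞 K),
          (GL (Fin 2) (RHat K) × GL (Fin 2) (InfiniteAdeleRing K)) ⧸ GamDiag (α c)) ≃
          GL (Fin 2) (Adele K) ⧸ principalGL K,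
        ∀ (c : ClassGroup (𝓞 K)) (x : GL (Fin 2) (RHat K))
          (g : GL (Fin 2) (InfiniteAdeleRing K)),
          Φ ⟨c, QuotientGroup.mk (x, g)⟩ =
            QuotientGroup.mk (rHatGL K x * bold (α c) * inftyGL K g)) ∧
    (∃ Ψ : (Σ c : ClassGroup (𝓞 K),
          GL (Fin 2) (RHat K) × (GL (Fin 2) (InfiniteAdeleRing K) ⧸ GamInfty (α c))) ≃
          GL (Fin 2) (Adele K) ⧸ principalGL K,
        (∀ (c : ClassGroup (𝓞 K)) (y x : GL (Fin 2) (RHat K))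
          (q : GL (Fin 2) (InfiniteAdeleRing K) ⧸ GamInfty (α c)),
          Ψ ⟨c, (y * x, q)⟩ = rHatGL K y • Ψ ⟨c, (x, q)⟩) ∧
        ∀ (c : ClassGroup (𝓞 K)) (x : GL (Fin 2) (RHat K))
          (g : GL (Fin 2) (InfiniteAdeleRing K)),
          ∃ x' : GL (Fin 2) (RHat K),
            Ψ ⟨c, (x, QuotientGroup.mk g)⟩ =
              QuotientGroup.mk (rHatGL K x' * bold (α c) * inftyGL K g)) := by
  have hclass {c c' : ClassGroup (𝓞 K)} {x x' : GL (Fin 2) (RHat K)}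
      {g g' : GL (Fin 2) (InfiniteAdeleRing K)}
      (h : (QuotientGroup.mk (rHatGL K x * bold (α c) * inftyGL K g) :
        GL (Fin 2) (Adele K) ⧸ principalGL K) =
        QuotientGroup.mk (rHatGL K x' * bold (α c') * inftyGL K g')) : c = c' := by
    obtain ⟨γ, h1, -⟩ := (mk_eq_mk_iff (hα.infinite_eq_one _) (hα.infinite_eq_one _) _ _ _ _).1 h
    rw [← hα.class_eq c, ← hα.class_eq c', mk_ideleIdeal_eq_of_conj h1]
  constructor
  · let f : (Σ c : ClassGroup (𝓞 K),
          (GL (Fin 2) (RHat K) × GL (Fin 2) (InfiniteAdeleRing K)) ⧸ GamDiag (α c)) →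
          GL (Fin 2) (Adele K) ⧸ principalGL K := fun s =>
      integralCosetMap (hα.infinite_eq_one s.1) s.2
    refine ⟨Equiv.ofBijective f ⟨?_, fun m => ?_⟩, fun _ _ _ => rfl⟩
    · rintro ⟨c, p⟩ ⟨c', q⟩ h
      induction p using QuotientGroup.induction_on with | H p
      induction q using QuotientGroup.induction_on with | H q
      obtain rfl := hclass h
      exact congrArg _ (QuotientGroup.eq.2
        ((mk_eq_mk_iff_mem_GamDiag (hα.infinite_eq_one c) p q).1 h))
    · induction m using QuotientGroup.induction_on with | H m
      obtain ⟨c, x, g, h⟩ := exists_decomposition hα m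
      exact ⟨⟨c, QuotientGroup.mk (x, g)⟩, h⟩
  · let f : (Σ c : ClassGroup (𝓞 K),
          GL (Fin 2) (RHat K) × (GL (Fin 2) (InfiniteAdeleRing K) ⧸ GamInfty (α c))) →
          GL (Fin 2) (Adele K) ⧸ principalGL K := fun s =>
      QuotientGroup.mk (rHatGL K s.2.1 * bold (α s.1) * inftyGL K s.2.2.out)
    -- Replacing the chosen representative by `g` introduces some `γ` in `Γ_α`; moved across `𝛂`, it
    -- becomes the right factor `y` in `GL_2(R̂)`, independent of `x`.
    have hf (c : ClassGroup (𝓞 K)) (g : GL (Fin 2) (InfiniteAdeleRing K)) :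
        ∃ y : GL (Fin 2) (RHat K), ∀ x, f ⟨c, (x, QuotientGroup.mk g)⟩ =
          QuotientGroup.mk (rHatGL K (x * y) * bold (α c) * inftyGL K g) := by
      have hg : (QuotientGroup.mk g : GL (Fin 2) (InfiniteAdeleRing K) ⧸ GamInfty (α c)).out⁻¹ * g
          ∈ GamInfty (α c) := QuotientGroup.eq.1 (QuotientGroup.out_eq' _)
      obtain ⟨γ, hγ, e⟩ := hg
      obtain ⟨y, hy⟩ := mem_Gam.1 hγ
      refine ⟨y, fun x => (mk_eq_mk_iff (hα.infinite_eq_one _) (hα.infinite_eq_one _) _ _ _ _).2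
        ⟨γ, ?_, eq_inv_mul_iff_mul_eq.1 e⟩⟩
      rw [map_mul, mul_assoc, mul_assoc, hy]
    refine ⟨Equiv.ofBijective f ⟨?_, fun m => ?_⟩, fun c y x q => ?_, fun c x g => ?_⟩
    · rintro ⟨c, x, q⟩ ⟨c', x', q'⟩ h
      obtain rfl := hclass h
      obtain ⟨γ, h1, h2⟩ :=
        (mk_eq_mk_iff (hα.infinite_eq_one _) (hα.infinite_eq_one _) _ _ _ _).1 h
      have hγ : γ ∈ Gam (α c) := mem_Gam.2 ⟨x⁻¹ * x', by
        rw [map_mul, map_inv, mul_assoc, eq_inv_mul_iff_mul_eq, ← mul_assoc, h1]⟩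
      have hq : q = q' := by
        rw [← QuotientGroup.out_eq' q, ← QuotientGroup.out_eq' q', QuotientGroup.eq]
        exact ⟨γ, hγ, eq_inv_mul_iff_mul_eq.2 h2⟩
      subst hq
      -- Equal cosets have the same chosen representative, so `γ` is trivial at infinity and hence
      -- trivial.
      have hγ1 : γ = 1 := diagInf_injective (by simpa using h2)
      subst hγ1
      rw [map_one, mul_one] at h1
      obtain rfl : x = x' := rHatFin_injective (mul_right_cancel h1)
      rfl
    · induction m using QuotientGroup.induction_on with | H m
      obtain ⟨c, x, g, h⟩ := exists_decomposition hα m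
      obtain ⟨y, hy⟩ := hf c g
      exact ⟨⟨c, (x * y⁻¹, QuotientGroup.mk g)⟩, by rw [hy, inv_mul_cancel_right, h]⟩
    · change f _ = rHatGL K y • f _
      simp only [f, map_mul, mul_assoc]
      rfl
    · obtain ⟨y, hy⟩ := hf c g
      exact ⟨x * y, hy x⟩
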